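/- For $n\ge 1$ let $\mathrm{Spin}(n)$ be the spin group of the quadratic form $-\sum_i x_i^2$ on $\mathbb{R}^n$, inside its Clifford algebra (so $e_i^2=-1$). An injective map $f:\{1,\dots,m\}\to\{1,\dots,n\}$ induces, via $e_k\mapsto e_{f(k)}$, a homomorphism $\mathrm{Spin}(m)\to\mathrm{Spin}(n)$; for increasing $f$ with image $\{i_1<\dots<i_m\}$ it is denoted $\tilde\varepsilon_{i_1\cdots i_m}$. Let $U$ be a group and $I$ a set. A $U$-amalgam over $I$ consists of a group $G_{ij}=G_{ji}$ for every two-element subset $\{i,j\}\subseteq I$ and monomorphisms $\phi_{ij}^i:U\to G_{ij}$, $\phi_{ij}^j:U\to G_{ij}$. An enveloping group of it is a group $G$ with homomorphisms $\tau_{ij}:G_{ij}\to G$ whose images generate $G$ and which satisfy $\tau_{ij}\circ\phi_{ij}^j=\tau_{kj}\circ\phi_{kj}^j$ for all $i\ne j\ne k$. It is universal if for each enveloping group $(H,\tau')$ there is a unique epimorphism $\pi:G\to H$ with $\pi\circ\tau_{ij}=\tau'_{ij}$ for all $i\neq j$. Let $n\ge 3$ and $I=\{1,\dots,n-1\}$,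 let $A_{n-1}$ be the diagram with vertices $1,\dots,n-1$ and edges $\{k,k+1\}$ for $1\le k\le n-2$, and let $\sigma$ be a labelling, i.e. a bijection from $I$ to the set of vertices. The standard $\mathrm{Spin}(2)$-amalgam $\mathcal{A}(A_{n-1},\sigma,\mathrm{Spin}(2))$ over $I$ is given, for $i<j$ in $I$, by $$G_{ij}=\mathrm{Spin}(3),\quad \phi_{ij}^i=\tilde\varepsilon_{12},\quad \phi_{ij}^j=\tilde\varepsilon_{23}\qquad\text{if }\sigma(i),\sigma(j)\text{ are adjacent},$$ $$G_{ij}=\mathrm{Spin}(2)\times\mathrm{Spin}(2),\quad \phi_{ij}^i(x)=(x,1),\quad \phi_{ij}^j(x)=(1,x)\qquad\text{otherwise}.$$ Theorem. For every $n\ge 3$ and every labelling $\sigma$, the group $\mathrm{Spin}(n)$ is a universal enveloping group of $\mathcal{A}(A_{n-1},\sigma,\mathrm{Spin}(2))$, with enveloping homomorphisms $\tau_{ij}:G_{ij}\to\mathrm{Spin}(n)$ such that $\tau_{ij}\circ\phi_{ij}^i=\tilde\varepsilon_{\sigma(i),\,\sigma(i)+1}$ for all $i\ne j$ in $I$. 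-/

import Mathlib

universe w u v x y

/-! ### Amalgams and their enveloping groups -/

/-- The unordered pairs `{i, j}` of distinct elements of `I`. -/
abbrev OffDiagPair (I : Type*) : Type _ := {e : Sym2 I // ¬ e.IsDiag}

/-- A `U`-amalgam over `I`: a group `G e` for each two-element subset `e = {i, j}` of `I`, and an
injective connecting homomorphism `φ e i : U → G e` for each element `i` of `e`. -/
structure UAmalgam (U : Type*) [Group U] (I : Type*) where
  /-- the group attached to the pair `e` -/
  G : OffDiagPair I → Type*
  [group : ∀ e, Group (G e)]
  /-- the connecting homomorphism attached to the pair `e` and its element `i` -/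
  φ : ∀ (e : OffDiagPair I) (i : I), i ∈ e.1 → U →* G e
  φ_injective : ∀ e i hi, Function.Injective (φ e i hi)

attribute [instance] UAmalgam.group

/-- `(H, τ)` is an enveloping group of the amalgam `A`: the images of the `τ e` generate `H`, and
`τ {i, j} ∘ φ {i, j} j = τ {k, j} ∘ φ {k, j} j` for all `i ≠ j ≠ k`. -/
structure UAmalgam.IsEnveloping {U : Type*} [Group U] {I : Type*} (A : UAmalgam U I)
    {H : Type*} [Group H] (τ : ∀ e, A.G e →* H) : Prop where
  generates : ⨆ e, (τ e).range = ⊤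
  compatible : ∀ (e e' : OffDiagPair I) (j : I) (hj : j ∈ e.1) (hj' : j ∈ e'.1),
    (τ e).comp (A.φ e j hj) = (τ e').comp (A.φ e' j hj')

/-- `(K, τ)` is a universal enveloping group of `A`: it is an enveloping group, and for each
enveloping group `(H, τ')` there is a unique epimorphism `π : K → H` with `π ∘ τ e = τ' e` for all
pairs `e`. The groups `H` range over an arbitrary fixed universe `w`. -/
structure UAmalgam.IsUniversalEnveloping {U : Type u} [Group U] {I : Type v}
    (A : UAmalgam.{u, v, x} U I) {K : Type y} [Group K] (τ : ∀ e, A.G e →* K) : Prop where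
  isEnveloping : A.IsEnveloping τ
  universal : ∀ (H : Type w) [Group H] (τ' : ∀ e, A.G e →* H), A.IsEnveloping τ' →
    ∃! π : K →* H, Function.Surjective π ∧ ∀ e, π.comp (τ e) = τ' e

/-! ### Spin groups and their standard embeddings -/

section spin

open CliffordAlgebra

/-- The standard quadratic form `x ↦ ∑ xᵢ²` on `ℝⁿ`. -/
noncomputable def stdForm (n : ℕ) : QuadraticForm ℝ (Fin n → ℝ) :=
  QuadraticMap.weightedSumSquares ℝ (fun _ : Fin n => (1 : ℝ))

theorem stdForm_apply {n : ℕ} (x : Fin n → ℝ) : stdForm n x = ∑ i, x i ^ 2 := by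
  simp [stdForm, QuadraticMap.weightedSumSquares_apply, sq]

/-- `Spin(n)`, inside the Clifford algebra of the negative definite form `-∑ xᵢ²`
(so that `eᵢ² = -1`). -/
abbrev Spin (n : ℕ) : Type := spinGroup (-stdForm n)

/-- The isometric embedding `ℝᵐ → ℝⁿ` that sends the basis vector `eₖ` to `e_{f k}`. -/
noncomputable def coordIsometry {m n : ℕ} (f : Fin m ↪ Fin n) :
    (-stdForm m) →qᵢ (-stdForm n) where
  toLinearMap := Function.ExtendByZero.linearMap ℝ f
  map_app' x := by
    have h : ∑ j, (Function.extend f x 0 j) ^ 2 = ∑ i, x i ^ 2 := by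
      rw [← Finset.sum_subset (Finset.subset_univ (Finset.univ.map f))]
      · rw [Finset.sum_map]
        exact Finset.sum_congr rfl fun i _ => by rw [f.injective.extend_apply]
      · intro j _ hj
        rw [Function.extend_apply']
        · simp
        · rintro ⟨a, rfl⟩
          exact hj (by simp)
    simpa [stdForm_apply] using h

theorem coordIsometry_single {m n : ℕ} (f : Fin m ↪ Fin n) (k : Fin m) :
    coordIsometry f (Pi.single k 1) = Pi.single (f k) 1 := by
  change Function.extend f (Pi.single k (1 : ℝ)) 0 = Pi.single (f k) 1
  funext j
  by_cases h : ∃ a, f a = j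
  · obtain ⟨a, rfl⟩ := h
    rw [f.injective.extend_apply]
    simp [Pi.single_apply]
  · rw [Function.extend_apply' _ _ _ h, Pi.single_eq_of_ne]
    · rfl
    · rintro rfl
      exact h ⟨k, rfl⟩

theorem map_mem_spinGroup {M N : Type*} [AddCommGroup M] [Module ℝ M] [AddCommGroup N] [Module ℝ N]
    {Q : QuadraticForm ℝ M} {Q' : QuadraticForm ℝ N} (f : Q →qᵢ Q') {x : CliffordAlgebra Q}
    (hx : x ∈ spinGroup Q) : CliffordAlgebra.map f x ∈ spinGroup Q' := by
  have hstar : ∀ y, star (CliffordAlgebra.map f y) = CliffordAlgebra.map f (star y) := by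
    intro y
    induction y using CliffordAlgebra.induction with
    | algebraMap r => simp [star_algebraMap]
    | ι v => simp
    | mul a b ha hb => simp [ha, hb]
    | add a b ha hb => simp [ha, hb]
  obtain ⟨⟨⟨u, hu, rfl⟩, h1, h2⟩, he⟩ := hx
  refine ⟨⟨⟨Units.map (CliffordAlgebra.map f).toRingHom.toMonoidHom u, ?_, rfl⟩, ?_, ?_⟩, ?_⟩
  · have hle : lipschitzGroup Q ≤ (lipschitzGroup Q').comap
        (Units.map (CliffordAlgebra.map f).toRingHom.toMonoidHom) := by
      refine (Subgroup.closure_le _).2 ?_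
      rintro v ⟨m, hm⟩
      refine Subgroup.subset_closure ⟨f m, ?_⟩
      simp [← hm]
    exact hle hu
  · rw [hstar, ← map_mul, h1, map_one]
  · rw [hstar, ← map_mul, h2, map_one]
  · have he' : (u : CliffordAlgebra Q) ∈ evenOdd Q 0 := he
    change CliffordAlgebra.map f (u : CliffordAlgebra Q) ∈ evenOdd Q' 0
    generalize (u : CliffordAlgebra Q) = y at he'
    induction y, he' using CliffordAlgebra.even_induction with
    | algebraMap r =>
      rw [AlgHom.commutes]
      exact (even Q').algebraMap_mem r
    | add _ _ _ _ h h' =>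
      rw [map_add]
      exact add_mem h h'
    | ι_mul_ι_mul m₁ m₂ y hy h =>
      rw [map_mul, map_mul, map_apply_ι, map_apply_ι]
      exact (even Q').mul_mem (ι_mul_ι_mem_evenOdd_zero Q' (f m₁) (f m₂)) h

/-- The standard embedding `ε̃_f : Spin(m) → Spin(n)` induced by `eₖ ↦ e_{f k}`. For increasing `f`
with image `{i₁ < ⋯ < iₘ}` this is the embedding usually written `ε̃_{i₁ ⋯ iₘ}`. -/
noncomputable def spinEmb {m n : ℕ} (f : Fin m ↪ Fin n) : Spin m →* Spin n where
  toFun x := ⟨CliffordAlgebra.map (coordIsometry f) x, map_mem_spinGroup _ x.2⟩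
  map_one' := Subtype.ext (map_one _)
  map_mul' _ _ := Subtype.ext (map_mul _ _ _)

theorem ι_single_mul_self {n : ℕ} (i : Fin n) :
    ι (-stdForm n) (Pi.single i 1) * ι (-stdForm n) (Pi.single i 1) = -1 := by
  rw [ι_sq_scalar]
  simp [stdForm_apply, Pi.single_apply]

theorem ι_single_mul_ι_single {n : ℕ} {i j : Fin n} (h : i ≠ j) :
    ι (-stdForm n) (Pi.single j 1) * ι (-stdForm n) (Pi.single i 1) =
      -(ι (-stdForm n) (Pi.single i 1) * ι (-stdForm n) (Pi.single j 1)) := by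
  have hsum : stdForm n (Pi.single j 1 + Pi.single i 1) = 2 := by
    have : ∀ k, ((Pi.single j 1 + Pi.single i 1 : Fin n → ℝ) k) ^ 2 =
        (if k = j then 1 else 0) + (if k = i then 1 else 0) := by
      intro k
      simp only [Pi.add_apply, Pi.single_apply]
      split_ifs <;> simp_all
    rw [stdForm_apply, Finset.sum_congr rfl fun k _ => this k, Finset.sum_add_distrib]
    simp
    norm_num
  have h1 : ∀ k, stdForm n (Pi.single k 1) = 1 := fun k => by
    simp [stdForm_apply, Pi.single_apply]
  have := ι_mul_ι_add_swap (Q := -stdForm n) (Pi.single j 1) (Pi.single i 1)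
  rw [eq_neg_iff_add_eq_zero, this]
  have hpol : QuadraticMap.polar (-stdForm n) (Pi.single j 1) (Pi.single i 1) = 0 := by
    simp only [QuadraticMap.polar, neg_apply, hsum, h1]
    norm_num
  rw [hpol, map_zero]

/-- Elements of `Spin(2)` have the form `a + b e₁e₂`. -/
theorem exists_eq_of_mem_even_two {x : CliffordAlgebra (-stdForm 2)}
    (hx : x ∈ evenOdd (-stdForm 2) 0) :
    ∃ a b : ℝ, x = algebraMap ℝ _ a +
      b • (ι (-stdForm 2) (Pi.single 0 1) * ι (-stdForm 2) (Pi.single 1 1)) := by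
  have hv : ∀ v : Fin 2 → ℝ, ι (-stdForm 2) v =
      v 0 • ι (-stdForm 2) (Pi.single 0 1) + v 1 • ι (-stdForm 2) (Pi.single 1 1) := by
    intro v
    rw [← map_smul, ← map_smul, ← map_add]
    congr 1
    funext k
    fin_cases k <;> simp
  have h00 := ι_single_mul_self (n := 2) 0
  have h11 := ι_single_mul_self (n := 2) 1
  have h10 := ι_single_mul_ι_single (n := 2) (i := 0) (j := 1) (by simp)
  induction x, hx using CliffordAlgebra.even_induction with
  | algebraMap r => exact ⟨r, 0, by simp⟩
  | add x y _ _ hx hy =>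
    obtain ⟨a, b, rfl⟩ := hx
    obtain ⟨c, d, rfl⟩ := hy
    exact ⟨a + c, b + d, by rw [map_add, add_smul]; abel⟩
  | ι_mul_ι_mul v w x _ h =>
    obtain ⟨a, b, rfl⟩ := h
    rw [hv v, hv w]
    set p := ι (-stdForm 2) (Pi.single 0 1)
    set q := ι (-stdForm 2) (Pi.single 1 1)
    have hpq : (p * q) * (p * q) = -1 := by
      rw [mul_assoc, ← mul_assoc q, h10, neg_mul, mul_assoc p q q, h11, mul_neg, mul_neg, mul_one,
        mul_neg, neg_neg, h00]
    have hvw : (v 0 • p + v 1 • q) * (w 0 • p + w 1 • q) =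
        (-(v 0 * w 0 + v 1 * w 1)) • 1 + (v 0 * w 1 - v 1 * w 0) • (p * q) := by
      simp only [add_mul, mul_add, smul_mul_smul_comm, h00, h11, h10]
      module
    refine ⟨-(v 0 * w 0 + v 1 * w 1) * a - (v 0 * w 1 - v 1 * w 0) * b,
      -(v 0 * w 0 + v 1 * w 1) * b + (v 0 * w 1 - v 1 * w 0) * a, ?_⟩
    rw [hvw, Algebra.algebraMap_eq_smul_one, Algebra.algebraMap_eq_smul_one]
    simp only [add_mul, mul_add, smul_mul_smul_comm, hpq, mul_one, one_mul]
    module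

theorem spinEmb_two_injective {n : ℕ} (f : Fin 2 ↪ Fin n) :
    Function.Injective (spinEmb f : Spin 2 →* Spin n) := by
  rw [injective_iff_map_eq_one]
  rintro ⟨x, hx⟩ h
  replace h : CliffordAlgebra.map (coordIsometry f) x = 1 := congrArg Subtype.val h
  obtain ⟨a, b, rfl⟩ := exists_eq_of_mem_even_two (spinGroup.mem_even hx)
  rw [map_add, AlgHom.commutes, map_smul, map_mul, map_apply_ι, map_apply_ι, coordIsometry_single,
    coordIsometry_single, Algebra.algebraMap_eq_smul_one] at h
  have h00 := ι_single_mul_self (f 0)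
  have h11 := ι_single_mul_self (f 1)
  have h10 := ι_single_mul_ι_single (i := f 0) (j := f 1) (by simp)
  set p := ι (-stdForm n) (Pi.single (f 0) 1)
  set q := ι (-stdForm n) (Pi.single (f 1) 1)
  have hp : p * (a • 1 + b • (p * q)) * p = -1 := by rw [h, mul_one, h00]
  have hp' : p * (a • 1 + b • (p * q)) * p = (-a) • 1 + b • (p * q) := by
    have : p * (p * q) * p = p * q := by
      rw [← mul_assoc p p q, h00, neg_mul, one_mul, neg_mul, h10, neg_neg]
    simp only [mul_add, add_mul, mul_smul_comm, smul_mul_assoc, mul_one, h00, this]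
    module
  rw [hp'] at hp
  have ha : (2 * (a - 1)) • (1 : CliffordAlgebra (-stdForm n)) = 0 := by
    have : (2 * (a - 1)) • (1 : CliffordAlgebra (-stdForm n)) =
        (a • 1 + b • (p * q)) - ((-a) • 1 + b • (p * q)) - (2 : ℝ) • 1 := by module
    rw [this, h, hp]
    module
  have ha' : a = 1 := by
    rcases smul_eq_zero.1 ha with h' | h'
    · linarith
    · exact absurd h' one_ne_zero
  subst ha'
  have hb : b • (p * q) = 0 := by simpa using h
  have hpq : (p * q) * (p * q) = -1 := by
    rw [mul_assoc, ← mul_assoc q, h10, neg_mul, mul_assoc p q q, h11, mul_neg, mul_neg, mul_one,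
      mul_neg, neg_neg, h00]
  rcases smul_eq_zero.1 hb with h' | h'
  · subst h'
    exact Subtype.ext (by simp)
  · rw [h', zero_mul] at hpq
    exact absurd (neg_eq_zero.1 hpq.symm) one_ne_zero

end spin

/-! ### The standard `Spin(2)`-amalgam of a simply laced diagram -/

/-- The rank two groups: `Spin(3)` for an edge, `Spin(2) × Spin(2)` for a non-edge. -/
def SpinRankTwo : Bool → Type
  | true => Spin 3
  | false => Spin 2 × Spin 2

noncomputable instance : ∀ b, Group (SpinRankTwo b)
  | true => inferInstanceAs (Group (Spin 3))
  | false => inferInstanceAs (Group (Spin 2 × Spin 2))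

/-- The connecting homomorphism at the smaller label: `ε̃₁₂` for an edge, `x ↦ (x, 1)` for a
non-edge. -/
noncomputable def spinLower : ∀ b, Spin 2 →* SpinRankTwo b
  | true => spinEmb (m := 2) (n := 3) Fin.castSuccEmb
  | false => MonoidHom.inl (Spin 2) (Spin 2)

/-- The connecting homomorphism at the larger label: `ε̃₂₃` for an edge, `x ↦ (1, x)` for a
non-edge. -/
noncomputable def spinUpper : ∀ b, Spin 2 →* SpinRankTwo b
  | true => spinEmb (m := 2) (n := 3) (Fin.succEmb 2)
  | false => MonoidHom.inr (Spin 2) (Spin 2)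

theorem spinLower_injective : ∀ b, Function.Injective (spinLower b)
  | true => spinEmb_two_injective _
  | false => fun _ _ h => congrArg Prod.fst h

theorem spinUpper_injective : ∀ b, Function.Injective (spinUpper b)
  | true => spinEmb_two_injective _
  | false => fun _ _ h => congrArg Prod.snd h

open Classical in
/-- The standard `Spin(2)`-amalgam with respect to a simply laced diagram `Γ` (a simple graph) and
a labelling `σ` of its vertices. -/
noncomputable def stdSpinAmalgam {I V : Type*} [LinearOrder I] (Γ : SimpleGraph V) (σ : I ≃ V) :
    UAmalgam (Spin 2) I where
  G e := SpinRankTwo (decide (e.1.map σ ∈ Γ.edgeSet))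
  φ e i _ := if i = e.1.inf then spinLower _ else spinUpper _
  φ_injective e i _ := by
    split_ifs
    · exact spinLower_injective _
    · exact spinUpper_injective _

/-- The map `{1, 2} → {1, …, n}` with image `{k, k + 1}`, where `1 ≤ k ≤ n - 1`
(in Lean, indices start at `0`). -/
def consecutive {n : ℕ} (k : Fin (n - 1)) : Fin 2 ↪ Fin n where
  toFun t := ⟨k + t, by omega⟩
  inj' s t h := by
    have := congrArg Fin.val h
    apply Fin.ext
    simpa using this

/-!
Let `h k : Spin(2) → H` be the homomorphisms that an enveloping group `H` attaches to the vertices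
`k` of the diagram. The isometry `e₁ ↦ -e₃`, `e₂ ↦ e₂`, `e₃ ↦ -e₁` of `ℝ³` exchanges the two
embeddings `ε̃₁₂` and `ε̃₂₃`, so the order of the labels does not matter: an enveloping group is the
same as a generating family `h` whose members at distinct vertices jointly extend to `Spin(3)` or
to `Spin(2) × Spin(2)` (`RankTwoRelations`). The embeddings `ε̃_{k, k+1}` are such a family in
`Spin(n)`, and they generate `Spin(n)` (`consecutiveSubgroup_eq_top`): rotations in the planes
`{k, k + 1}` move every vector to a multiple of the last basis vector, and this vector normalizes
the group which they generate, so that an element of the Lipschitz group is, up to a scalar, in this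
group or in its coset of the last basis vector; parity excludes the coset.

It remains to extend every such family `h` to `Spin(n)` (`RankTwoRelations.exists_hom`). The pairs
`(h k a, ε̃_{k, k+1} a)` generate the graph of the extension if the projection of the group that
they generate to `Spin(n)` is injective. Let `A_k` be the `k`-th copy of `Spin(2)` in that group
and `U_m` the group generated by the first `m` of them. Euler angles in `Spin(3)` give
`A_{m+1} A_m A_{m+1} ⊆ A_m A_{m+1} A_m`, and distant copies commute; these two facts alone yield
`U_{m+1} = U_m A_m U_m` by induction (`exists_eq_mul_mul_of_mem_initialSup`). Now suppose that
`k a k'`, with `k, k' ∈ U_m` and `a ∈ A_m`, lies over `1`. Then `a` lies over the image of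
`U_m`, which centralizes the basis vector that `A_m` moves and `U_m` does not. Hence `a` is the
image of `±1`. As neighbouring copies of `Spin(2)` share `-1`, the element lies in `U_m`, and
induction on `m` finishes the proof (`eq_one_of_mem_initialSup_of_snd_eq_one`).
-/

open CliffordAlgebra

/-! ### Rotations generated by a square root of `-1` -/

section rotor

variable {A : Type*} [Ring A] [Algebra ℝ A]

/-- The element `cos θ + sin θ p` of a real algebra; if `p² = -1`, then this is `exp (θ p)`. -/
noncomputable def rotor (p : A) (θ : ℝ) : A := Real.cos θ • (1 : A) + Real.sin θ • p

theorem rotor_zero (p : A) : rotor p 0 = 1 := by simp [rotor]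

theorem rotor_pi (p : A) : rotor p Real.pi = -1 := by simp [rotor]

theorem rotor_neg_left (p : A) (θ : ℝ) : rotor (-p) θ = rotor p (-θ) := by
  simp [rotor]

theorem rotor_add {p : A} (hp : p * p = -1) (s t : ℝ) :
    rotor p (s + t) = rotor p s * rotor p t := by
  simp only [rotor, Real.cos_add, Real.sin_add, add_mul, mul_add, smul_mul_smul_comm, hp, one_mul,
    mul_one]
  module

theorem rotor_mul_rotor_neg {p : A} (hp : p * p = -1) (t : ℝ) :
    rotor p t * rotor p (-t) = 1 := by
  rw [← rotor_add hp, add_neg_cancel, rotor_zero]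

theorem Commute.rotor_right {p x : A} (h : Commute x p) (t : ℝ) : Commute x (rotor p t) :=
  ((Commute.one_right x).smul_right _).add_right (h.smul_right _)

theorem Commute.rotor_rotor {p q : A} (h : Commute p q) (s t : ℝ) :
    Commute (rotor p s) (rotor q t) :=
  (h.symm.rotor_right s).symm.rotor_right t

/-- If `p` and `q` generate a copy of the quaternions, then a product of three rotors in `p`, `q`,
`p` has these quaternion coordinates. -/
theorem rotor_mul_rotor_mul_rotor {p q : A} (hp : p * p = -1) (hqp : q * p = -(p * q))
    (a b c : ℝ) :
    rotor p a * rotor q b * rotor p c =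
      (Real.cos b * Real.cos (a + c)) • (1 : A) + (Real.cos b * Real.sin (a + c)) • p +
        (Real.sin b * Real.cos (a - c)) • q + (Real.sin b * Real.sin (a - c)) • (p * q) := by
  have h1 : p * q * p = q := by rw [mul_assoc, hqp, mul_neg, ← mul_assoc, hp, neg_one_mul, neg_neg]
  simp only [rotor, Real.cos_add, Real.sin_add, Real.cos_sub, Real.sin_sub, add_mul, mul_add,
    smul_mul_smul_comm, hp, hqp, h1, one_mul, mul_one]
  module

theorem exists_polar (x y : ℝ) : ∃ r θ : ℝ, x = r * Real.cos θ ∧ y = r * Real.sin θ := by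
  refine ⟨‖(⟨x, y⟩ : ℂ)‖, Complex.arg ⟨x, y⟩, ?_, ?_⟩
  · rw [Complex.norm_mul_cos_arg]
  · rw [Complex.norm_mul_sin_arg]

theorem exists_cos_sin_eq {x y : ℝ} (h : x ^ 2 + y ^ 2 = 1) :
    ∃ θ : ℝ, x = Real.cos θ ∧ y = Real.sin θ := by
  refine ⟨Complex.arg ⟨x, y⟩, ?_⟩
  have hn : ‖(⟨x, y⟩ : ℂ)‖ = 1 := by
    rw [← sq_eq_sq₀ (norm_nonneg _) zero_le_one, ← Complex.normSq_eq_norm_sq, Complex.normSq_mk]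
    linarith
  have h1 := Complex.norm_mul_cos_arg ⟨x, y⟩
  have h2 := Complex.norm_mul_sin_arg ⟨x, y⟩
  rw [hn, one_mul] at h1 h2
  exact ⟨h1.symm, h2.symm⟩

/-- Euler angles: in the unit quaternions, a product of rotations about the axes `p`, `q`, `p` is
also a product of rotations about the axes `q`, `p`, `q`. -/
theorem exists_rotor_euler {p q : A} (hp : p * p = -1) (hq : q * q = -1) (hqp : q * p = -(p * q))
    (a b c : ℝ) :
    ∃ α β γ, rotor p a * rotor q b * rotor p c = rotor q α * rotor p β * rotor q γ := by
  -- In `rotor q α * rotor p β * rotor q γ`, the coordinates at `1`, `q` are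
  -- `cos β (cos (α + γ), sin (α + γ))` and those at `p`, `q p` are
  -- `sin β (cos (α - γ), sin (α - γ))`, so `α ± γ` and `β` are read off from polar coordinates.
  obtain ⟨r, u, h1, h2⟩ := exists_polar (Real.cos b * Real.cos (a + c))
    (Real.sin b * Real.cos (a - c))
  obtain ⟨s, v, h3, h4⟩ := exists_polar (Real.cos b * Real.sin (a + c))
    (-(Real.sin b * Real.sin (a - c)))
  have hrs : r ^ 2 + s ^ 2 = 1 := by
    have hr : r ^ 2 = (r * Real.cos u) ^ 2 + (r * Real.sin u) ^ 2 := by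
      linear_combination (-r ^ 2) * Real.sin_sq_add_cos_sq u
    have hs : s ^ 2 = (s * Real.cos v) ^ 2 + (s * Real.sin v) ^ 2 := by
      linear_combination (-s ^ 2) * Real.sin_sq_add_cos_sq v
    rw [hr, hs, ← h1, ← h2, ← h3, ← h4]
    linear_combination Real.sin_sq_add_cos_sq b + Real.cos b ^ 2 * Real.sin_sq_add_cos_sq (a + c) +
      Real.sin b ^ 2 * Real.sin_sq_add_cos_sq (a - c)
  obtain ⟨β, rfl, rfl⟩ := exists_cos_sin_eq hrs
  refine ⟨(u + v) / 2, β, (u - v) / 2, ?_⟩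
  have hpq : p * q = -(q * p) := by rw [hqp, neg_neg]
  rw [rotor_mul_rotor_mul_rotor hp hqp, rotor_mul_rotor_mul_rotor hq hpq,
    show (u + v) / 2 + (u - v) / 2 = u by ring, show (u + v) / 2 - (u - v) / 2 = v by ring,
    ← h1, ← h2, ← h3, ← h4, hqp]
  module

end rotor

/-! ### Rotors in the spin groups -/

section spinRotor

/-- The bivector `e_i e_j` in the Clifford algebra of `-∑ xₖ²`. -/
noncomputable def bivec {n : ℕ} (i j : Fin n) : CliffordAlgebra (-stdForm n) :=
  ι (-stdForm n) (Pi.single i 1) * ι (-stdForm n) (Pi.single j 1)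

theorem bivec_swap {n : ℕ} {i j : Fin n} (h : i ≠ j) : bivec j i = -bivec i j :=
  ι_single_mul_ι_single h

theorem bivec_mul_self {n : ℕ} {i j : Fin n} (h : i ≠ j) : bivec i j * bivec i j = -1 := by
  rw [bivec, mul_assoc, ← mul_assoc (ι _ (Pi.single j 1)), ι_single_mul_ι_single h, neg_mul,
    mul_assoc, ι_single_mul_self, mul_neg, mul_neg, mul_neg, mul_one, neg_neg, ι_single_mul_self]

theorem commute_ι_single_bivec {n : ℕ} {i j k : Fin n} (hi : i ≠ k) (hj : j ≠ k) :
    Commute (ι (-stdForm n) (Pi.single k 1)) (bivec i j) := by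
  rw [Commute, SemiconjBy, bivec, ← mul_assoc, ι_single_mul_ι_single hi, neg_mul, mul_assoc,
    ι_single_mul_ι_single hj, mul_neg, neg_neg, mul_assoc]

theorem commute_bivec_bivec {n : ℕ} {i j k l : Fin n} (hik : i ≠ k) (hjk : j ≠ k) (hil : i ≠ l)
    (hjl : j ≠ l) : Commute (bivec i j) (bivec k l) :=
  ((commute_ι_single_bivec hik hjk).mul_left (commute_ι_single_bivec hil hjl)).symm

/-- Two bivectors that share one basis vector generate a copy of the quaternions. -/
theorem bivec_mul_bivec_swap {n : ℕ} {i j k : Fin n} (hij : i ≠ j) (hjk : j ≠ k) (hik : i ≠ k) :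
    bivec j k * bivec i j = -(bivec i j * bivec j k) := by
  have h : ι (-stdForm n) (Pi.single j 1) * bivec i j =
      -(bivec i j * ι (-stdForm n) (Pi.single j 1)) := by
    rw [bivec, ← mul_assoc, ι_single_mul_ι_single hij, neg_mul]
  rw [bivec.eq_1 j k, mul_assoc, (commute_ι_single_bivec hik hjk).eq, ← mul_assoc, h, neg_mul,
    mul_assoc]

theorem ι_mul_self_of_stdForm_eq_one {n : ℕ} {v : Fin n → ℝ} (hv : stdForm n v = 1) :
    ι (-stdForm n) v * ι (-stdForm n) v = -1 := by
  rw [ι_sq_scalar]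
  simp [hv]

theorem ι_mem_pinGroup {n : ℕ} {v : Fin n → ℝ} (hv : stdForm n v = 1) :
    ι (-stdForm n) v ∈ pinGroup (-stdForm n) := by
  have hsq := ι_mul_self_of_stdForm_eq_one hv
  refine pinGroup.mem_iff.2 ⟨⟨⟨ι _ v, -ι _ v, by simp [hsq], by simp [hsq]⟩, ?_, rfl⟩, ?_⟩
  · exact Subgroup.subset_closure ⟨v, rfl⟩
  · rw [Unitary.mem_iff]
    simp [star_def, hsq]

theorem ι_mul_ι_mem_spinGroup {n : ℕ} {v w : Fin n → ℝ} (hv : stdForm n v = 1)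
    (hw : stdForm n w = 1) : ι (-stdForm n) v * ι (-stdForm n) w ∈ spinGroup (-stdForm n) :=
  spinGroup.mem_iff.2 ⟨mul_mem (ι_mem_pinGroup hv) (ι_mem_pinGroup hw),
    ι_mul_ι_mem_evenOdd_zero _ v w⟩

theorem rotor_bivec_mem_spinGroup_two (θ : ℝ) :
    rotor (bivec (n := 2) 0 1) θ ∈ spinGroup (-stdForm 2) := by
  have h : rotor (bivec (n := 2) 0 1) θ = ι (-stdForm 2) (Pi.single 0 1) *
      ι (-stdForm 2) (-(Real.cos θ • Pi.single 0 1) + Real.sin θ • Pi.single 1 1) := by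
    rw [map_add, map_neg, map_smul, map_smul, mul_add, mul_neg, mul_smul_comm, mul_smul_comm,
      ι_single_mul_self, rotor, bivec]
    simp
  rw [h]
  apply ι_mul_ι_mem_spinGroup
  · simp [stdForm_apply]
  · simp [stdForm_apply]

/-- The element `cos θ + sin θ e₁e₂` of `Spin(2)`. -/
noncomputable def spinRot (θ : ℝ) : Spin 2 := ⟨_, rotor_bivec_mem_spinGroup_two θ⟩

theorem exists_eq_spinRot (x : Spin 2) : ∃ θ, x = spinRot θ := by
  obtain ⟨x, hx⟩ := x
  obtain ⟨a, b, rfl⟩ := exists_eq_of_mem_even_two (spinGroup.mem_even hx)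
  have h := spinGroup.mul_star_self_of_mem hx
  have hb := bivec_mul_self (n := 2) (i := 0) (j := 1) (by simp)
  have hb' := bivec_swap (n := 2) (i := 0) (j := 1) (by simp)
  have hs : star (bivec (n := 2) 0 1) = -bivec 0 1 := by
    rw [← hb', bivec, star_mul, star_ι, star_ι, neg_mul_neg, bivec]
  change (algebraMap ℝ _ a + b • bivec 0 1) * star (algebraMap ℝ _ a + b • bivec 0 1) = 1 at h
  rw [star_add, star_algebraMap, CliffordAlgebra.star_smul, hs, Algebra.algebraMap_eq_smul_one] at h
  have h2 : (a ^ 2 + b ^ 2 - 1) • (1 : CliffordAlgebra (-stdForm 2)) = 0 := by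
    simp only [add_mul, mul_add, smul_mul_smul_comm, mul_neg, smul_neg, hb, one_mul, mul_one] at h
    rw [← sub_eq_zero] at h
    rw [← h]
    module
  have h3 : a ^ 2 + b ^ 2 = 1 := by
    rcases smul_eq_zero.1 h2 with h' | h'
    · linarith
    · exact absurd h' one_ne_zero
  obtain ⟨θ, rfl, rfl⟩ := exists_cos_sin_eq h3
  refine ⟨θ, Subtype.ext ?_⟩
  change algebraMap ℝ _ _ + _ = _
  rw [Algebra.algebraMap_eq_smul_one]
  rfl

theorem spinRot_zero : spinRot 0 = 1 := Subtype.ext (rotor_zero _)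

theorem spinRot_add (s t : ℝ) : spinRot (s + t) = spinRot s * spinRot t :=
  Subtype.ext (rotor_add (bivec_mul_self (by simp)) s t)

theorem spinRot_inv (t : ℝ) : (spinRot t)⁻¹ = spinRot (-t) := by
  rw [inv_eq_iff_mul_eq_one, ← spinRot_add, add_neg_cancel, spinRot_zero]

/-- The homomorphism of spin groups induced by an isometry of quadratic spaces. -/
noncomputable def spinMap {M N : Type*} [AddCommGroup M] [Module ℝ M] [AddCommGroup N] [Module ℝ N]
    {Q : QuadraticForm ℝ M} {Q' : QuadraticForm ℝ N} (f : Q →qᵢ Q') :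
    spinGroup Q →* spinGroup Q' where
  toFun x := ⟨CliffordAlgebra.map f x, map_mem_spinGroup _ x.2⟩
  map_one' := Subtype.ext (map_one _)
  map_mul' _ _ := Subtype.ext (map_mul _ _ _)

theorem coe_spinEmb_spinRot {n : ℕ} (f : Fin 2 ↪ Fin n) (θ : ℝ) :
    (spinEmb f (spinRot θ) : CliffordAlgebra (-stdForm n)) = rotor (bivec (f 0) (f 1)) θ := by
  change CliffordAlgebra.map (coordIsometry f) (rotor (bivec 0 1) θ) = _
  simp only [rotor, bivec, map_add, map_smul, map_one, map_mul, map_apply_ι, coordIsometry_single]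

/-- Euler angles in `Spin(n)`, for two coordinate planes that meet in a line. -/
theorem exists_spinEmb_euler {n : ℕ} {f g : Fin 2 ↪ Fin n} (h : f 1 = g 0) (h' : f 0 ≠ g 1)
    (a b c : Spin 2) :
    ∃ a' b' c', spinEmb g a * spinEmb f b * spinEmb g c =
      spinEmb f a' * spinEmb g b' * spinEmb f c' := by
  obtain ⟨a, rfl⟩ := exists_eq_spinRot a
  obtain ⟨b, rfl⟩ := exists_eq_spinRot b
  obtain ⟨c, rfl⟩ := exists_eq_spinRot c
  have hf : f 0 ≠ f 1 := by simp
  have hg : g 0 ≠ g 1 := by simp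
  have hqp : bivec (g 0) (g 1) * bivec (f 0) (f 1) = -(bivec (f 0) (f 1) * bivec (g 0) (g 1)) := by
    rw [← h] at hg ⊢
    exact bivec_mul_bivec_swap hf hg h'
  obtain ⟨α, β, γ, H⟩ := exists_rotor_euler (bivec_mul_self hg) (bivec_mul_self hf)
    (neg_eq_iff_eq_neg.2 hqp).symm a b c
  refine ⟨spinRot α, spinRot β, spinRot γ, Subtype.ext ?_⟩
  simpa only [Submonoid.coe_mul, coe_spinEmb_spinRot] using H

/-- All the embeddings `Spin(2) → Spin(n)` agree at `-1`. -/
theorem spinEmb_spinRot_pi {n : ℕ} (f g : Fin 2 ↪ Fin n) :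
    spinEmb f (spinRot Real.pi) = spinEmb g (spinRot Real.pi) :=
  Subtype.ext (by rw [coe_spinEmb_spinRot, coe_spinEmb_spinRot, rotor_pi, rotor_pi])

theorem commute_spinEmb {n : ℕ} {f g : Fin 2 ↪ Fin n} (h : ∀ s t, f s ≠ g t) (a b : Spin 2) :
    Commute (spinEmb f a) (spinEmb g b) := by
  obtain ⟨a, rfl⟩ := exists_eq_spinRot a
  obtain ⟨b, rfl⟩ := exists_eq_spinRot b
  refine Subtype.ext ?_
  simp only [Submonoid.coe_mul, coe_spinEmb_spinRot]
  exact Commute.rotor_rotor (commute_bivec_bivec (h _ _) (h _ _) (h _ _) (h _ _)) a b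

end spinRotor

/-! ### Generation of the spin groups -/

section generation

/-- The subgroup of `Spin(n)` generated by the copies of `Spin(2)` in the coordinate planes
`{k, k + 1}`. -/
noncomputable def consecutiveSubgroup (n : ℕ) : Subgroup (Spin n) :=
  ⨆ k : Fin (n - 1), (spinEmb (consecutive k)).range

theorem spinEmb_mem_consecutiveSubgroup {n : ℕ} (k : Fin (n - 1)) (x : Spin 2) :
    spinEmb (consecutive k) x ∈ consecutiveSubgroup n :=
  Subgroup.mem_iSup_of_mem k ⟨x, rfl⟩

theorem coe_mul_coe_inv {n : ℕ} (g : Spin n) :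
    (g : CliffordAlgebra (-stdForm n)) * (g⁻¹ : Spin n) = 1 := by
  rw [← Submonoid.coe_mul, mul_inv_cancel, Submonoid.coe_one]

theorem coe_inv_mul_coe {n : ℕ} (g : Spin n) :
    ((g⁻¹ : Spin n) : CliffordAlgebra (-stdForm n)) * g = 1 := by
  rw [← Submonoid.coe_mul, inv_mul_cancel, Submonoid.coe_one]

theorem ι_mul_ι_single_of_apply_eq_zero {n : ℕ} {v : Fin n → ℝ} {i : Fin n} (h : v i = 0) :
    ι (-stdForm n) v * ι (-stdForm n) (Pi.single i 1) =
      -(ι (-stdForm n) (Pi.single i 1) * ι (-stdForm n) v) := by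
  rw [eq_neg_iff_add_eq_zero, ι_mul_ι_add_swap]
  have hpol : QuadraticMap.polar (-stdForm n) v (Pi.single i 1) = 0 := by
    have : stdForm n (v + Pi.single i 1) = stdForm n v + stdForm n (Pi.single i 1) := by
      rw [stdForm_apply, stdForm_apply, stdForm_apply, ← Finset.sum_add_distrib]
      refine Finset.sum_congr rfl fun k _ => ?_
      rcases eq_or_ne k i with rfl | hk
      · simp [h]
      · simp [hk]
    simp only [QuadraticMap.polar, neg_apply, this]
    ring
  rw [hpol, map_zero]

theorem commute_ι_bivec {n : ℕ} {v : Fin n → ℝ} {i j : Fin n} (hi : v i = 0) (hj : v j = 0) :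
    Commute (ι (-stdForm n) v) (bivec i j) := by
  rw [Commute, SemiconjBy, bivec, ← mul_assoc, ι_mul_ι_single_of_apply_eq_zero hi, neg_mul,
    mul_assoc, ι_mul_ι_single_of_apply_eq_zero hj, mul_neg, neg_neg, mul_assoc]

/-- Conjugation by the rotor of angle `t` in the plane `{i, j}` is the rotation by `2t`. -/
theorem rotor_mul_ι_mul_rotor {n : ℕ} {i j : Fin n} (hij : i ≠ j) (v : Fin n → ℝ) (t : ℝ) :
    ∃ w : Fin n → ℝ, rotor (bivec i j) t * ι (-stdForm n) v * rotor (bivec i j) (-t) =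
        ι (-stdForm n) w ∧
      w i = Real.cos (2 * t) * v i - Real.sin (2 * t) * v j ∧
      ∀ k, k ≠ i → k ≠ j → w k = v k := by
  obtain ⟨r, hr⟩ : ∃ r, r = v - v i • Pi.single i 1 - v j • Pi.single j 1 := ⟨_, rfl⟩
  have hv : v = v i • Pi.single i 1 + v j • Pi.single j 1 + r := by rw [hr]; abel
  have hri : r i = 0 := by simp [hr, hij]
  have hrj : r j = 0 := by simp [hr, hij.symm]
  have hcomm : rotor (bivec i j) t * ι (-stdForm n) r = ι (-stdForm n) r * rotor (bivec i j) t :=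
    ((commute_ι_bivec hri hrj).rotor_right t).symm.eq
  have hii := ι_single_mul_self i
  have hjj := ι_single_mul_self j
  have hji := ι_single_mul_ι_single hij
  have h1 : bivec i j * ι (-stdForm n) (Pi.single i 1) = ι (-stdForm n) (Pi.single j 1) := by
    rw [bivec, mul_assoc, hji, mul_neg, ← mul_assoc, hii, neg_one_mul, neg_neg]
  have h2 : bivec i j * ι (-stdForm n) (Pi.single j 1) = -ι (-stdForm n) (Pi.single i 1) := by
    rw [bivec, mul_assoc, hjj, mul_neg, mul_one]
  have h3 : ι (-stdForm n) (Pi.single i 1) * bivec i j = -ι (-stdForm n) (Pi.single j 1) := by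
    rw [bivec, ← mul_assoc, hii, neg_one_mul]
  have h4 : ι (-stdForm n) (Pi.single j 1) * bivec i j = ι (-stdForm n) (Pi.single i 1) := by
    rw [bivec, ← mul_assoc, hji, neg_mul, mul_assoc, hjj, mul_neg, mul_one, neg_neg]
  refine ⟨(Real.cos (2 * t) * v i - Real.sin (2 * t) * v j) • Pi.single i 1 +
    (Real.sin (2 * t) * v i + Real.cos (2 * t) * v j) • Pi.single j 1 + r, ?_, ?_, ?_⟩
  · conv_lhs => rw [hv]
    rw [map_add, mul_add, add_mul, hcomm, mul_assoc (ι _ r),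
      rotor_mul_rotor_neg (bivec_mul_self hij), mul_one, map_add (ι _) _ r]
    congr 1
    simp only [map_add, map_smul]
    have hflip : ∀ a b : ℝ, (a • ι (-stdForm n) (Pi.single i 1) +
          b • ι (-stdForm n) (Pi.single j 1)) * rotor (bivec i j) (-t) =
        rotor (bivec i j) t * (a • ι (-stdForm n) (Pi.single i 1) +
          b • ι (-stdForm n) (Pi.single j 1)) := by
      intro a b
      simp only [rotor, Real.cos_neg, Real.sin_neg, add_mul, mul_add, smul_mul_smul_comm, h1, h2,
        h3, h4, one_mul, mul_one]
      module
    have hmul : ∀ a b : ℝ, rotor (bivec i j) (2 * t) * (a • ι (-stdForm n) (Pi.single i 1) +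
          b • ι (-stdForm n) (Pi.single j 1)) =
        (Real.cos (2 * t) * a - Real.sin (2 * t) * b) • ι (-stdForm n) (Pi.single i 1) +
        (Real.sin (2 * t) * a + Real.cos (2 * t) * b) • ι (-stdForm n) (Pi.single j 1) := by
      intro a b
      simp only [rotor, add_mul, mul_add, smul_mul_smul_comm, h1, h2, one_mul]
      module
    rw [mul_assoc, hflip, ← mul_assoc, ← rotor_add (bivec_mul_self hij), ← two_mul, hmul]
  · simp [hri, hij]
  · intro k hki hkj
    simp [hr, hki, hkj]

theorem exists_cos_mul_eq_sin_mul (x y : ℝ) :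
    ∃ t : ℝ, Real.cos (2 * t) * x - Real.sin (2 * t) * y = 0 := by
  obtain ⟨r, θ, rfl, rfl⟩ := exists_polar y x
  refine ⟨θ / 2, ?_⟩
  rw [mul_div_cancel₀ _ two_ne_zero]
  ring

theorem coe_spinEmb_consecutive {n : ℕ} (k : Fin (n - 1)) (t : ℝ) :
    (spinEmb (consecutive k) (spinRot t) : CliffordAlgebra (-stdForm n)) =
      rotor (bivec ⟨k, by omega⟩ ⟨k + 1, by omega⟩) t :=
  coe_spinEmb_spinRot _ _

/-- Rotations in the planes `{k, k + 1}` annihilate the coordinates of a vector one by one. -/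
theorem exists_conj_apply_eq_zero {n : ℕ} (v : Fin n → ℝ) (m : ℕ) (hm : m ≤ n - 1) :
    ∃ g ∈ consecutiveSubgroup n, ∃ w : Fin n → ℝ,
      (g : CliffordAlgebra (-stdForm n)) * ι (-stdForm n) v * (g⁻¹ : Spin n) =
        ι (-stdForm n) w ∧ ∀ i : Fin n, i.val < m → w i = 0 := by
  induction m with
  | zero => exact ⟨1, one_mem _, v, by simp, by simp⟩
  | succ m ih =>
    obtain ⟨g, hg, w, hw, hw0⟩ := ih (by omega)
    let k : Fin (n - 1) := ⟨m, by omega⟩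
    obtain ⟨t, ht⟩ := exists_cos_mul_eq_sin_mul (w ⟨m, by omega⟩) (w ⟨m + 1, by omega⟩)
    obtain ⟨w', h1, h2, h3⟩ := rotor_mul_ι_mul_rotor (i := (⟨m, by omega⟩ : Fin n))
      (j := ⟨m + 1, by omega⟩) (by simp) w t
    refine ⟨spinEmb (consecutive k) (spinRot t) * g,
      mul_mem (spinEmb_mem_consecutiveSubgroup k _) hg, w', ?_, ?_⟩
    · rw [mul_inv_rev, ← map_inv, spinRot_inv, Submonoid.coe_mul, Submonoid.coe_mul,
        coe_spinEmb_consecutive, coe_spinEmb_consecutive, ← h1, ← hw]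
      simp only [mul_assoc, k]
    · intro i hi
      rcases Nat.lt_succ_iff_lt_or_eq.1 hi with hi | hi
      · rw [h3 i (Fin.ne_of_val_ne (by simp; omega)) (Fin.ne_of_val_ne (by simp; omega)), hw0 i hi]
      · rw [show i = ⟨m, by omega⟩ from Fin.ext hi, h2, ht]

/-- Up to a scalar, every vector is conjugate to the last basis vector. -/
theorem exists_ι_eq_smul_conj {n : ℕ} {l : Fin n} (hl : l.val = n - 1) (v : Fin n → ℝ) :
    ∃ g ∈ consecutiveSubgroup n, ∃ c : ℝ, ι (-stdForm n) v =
      c • ((g : CliffordAlgebra (-stdForm n)) * ι (-stdForm n) (Pi.single l 1) *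
        (g⁻¹ : Spin n)) := by
  obtain ⟨g, hg, w, hw, hw0⟩ := exists_conj_apply_eq_zero v (n - 1) le_rfl
  have hwl : w = w l • Pi.single l 1 := by
    funext i
    rcases eq_or_ne i l with rfl | hi
    · simp
    · have : i.val < n - 1 := by
        have := Fin.val_ne_of_ne hi
        omega
      simp [hi, hw0 i this]
  refine ⟨g⁻¹, inv_mem hg, w l, ?_⟩
  have : ι (-stdForm n) v = (g⁻¹ : Spin n) * ι (-stdForm n) w * g := by
    rw [← hw]
    simp only [mul_assoc, coe_inv_mul_coe, mul_one]
    rw [← mul_assoc, coe_inv_mul_coe, one_mul]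
  rw [this, hwl, map_smul, mul_smul_comm, smul_mul_assoc, inv_inv]
  simp

/-- The last basis vector normalizes the group generated by the `Spin(2)` in the planes
`{k, k + 1}`. -/
theorem exists_ι_last_mul {n : ℕ} {l : Fin n} (hl : l.val = n - 1) {g : Spin n}
    (hg : g ∈ consecutiveSubgroup n) :
    ∃ g' ∈ consecutiveSubgroup n, ι (-stdForm n) (Pi.single l 1) * g =
      g' * ι (-stdForm n) (Pi.single l 1) := by
  rw [consecutiveSubgroup] at hg
  refine Subgroup.iSup_induction _ (C := fun g : Spin n => ∃ g' ∈ consecutiveSubgroup n,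
    ι (-stdForm n) (Pi.single l 1) * (g : CliffordAlgebra (-stdForm n)) =
      g' * ι (-stdForm n) (Pi.single l 1)) hg ?_ ⟨1, one_mem _, by simp⟩ ?_
  · rintro k _ ⟨x, rfl⟩
    obtain ⟨t, rfl⟩ := exists_eq_spinRot x
    by_cases hk : k.val + 1 = l.val
    · refine ⟨_, spinEmb_mem_consecutiveSubgroup k (spinRot (-t)), ?_⟩
      have hkl : (⟨k + 1, by omega⟩ : Fin n) = l := Fin.ext hk
      rw [coe_spinEmb_consecutive, coe_spinEmb_consecutive, ← rotor_neg_left, hkl]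
      have : ι (-stdForm n) (Pi.single l 1) * bivec ⟨k, by omega⟩ l =
          -bivec ⟨k, by omega⟩ l * ι (-stdForm n) (Pi.single l 1) := by
        rw [bivec, ← mul_assoc, ι_single_mul_ι_single (Fin.ne_of_val_ne (by simp; omega))]
      rw [rotor, mul_add, mul_smul_comm, mul_smul_comm, this, rotor, add_mul, smul_mul_assoc,
        smul_mul_assoc, one_mul, mul_one]
    · refine ⟨_, spinEmb_mem_consecutiveSubgroup k (spinRot t), ?_⟩
      rw [coe_spinEmb_consecutive]
      exact (commute_ι_single_bivec (Fin.ne_of_val_ne (by simp; omega))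
        (Fin.ne_of_val_ne (by simp; omega))).rotor_right t
  · rintro g h ⟨g', hg', hgg'⟩ ⟨h', hh', hhh'⟩
    refine ⟨g' * h', mul_mem hg' hh', ?_⟩
    rw [Submonoid.coe_mul, Submonoid.coe_mul, ← mul_assoc, hgg', mul_assoc, hhh', mul_assoc]

/-- Up to a scalar, an element of the Lipschitz group is an element of the group generated by the
`Spin(2)` in the planes `{k, k + 1}`, possibly times the last basis vector. -/
theorem exists_eq_smul_of_mem_lipschitzGroup {n : ℕ} {l : Fin n} (hl : l.val = n - 1)
    {u : (CliffordAlgebra (-stdForm n))ˣ} (hu : u ∈ lipschitzGroup (-stdForm n)) :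
    ∃ g ∈ consecutiveSubgroup n, ∃ c : ℝ, (u : CliffordAlgebra (-stdForm n)) = c • (g : _) ∨
      (u : CliffordAlgebra (-stdForm n)) = c • (g * ι (-stdForm n) (Pi.single l 1)) := by
  have hll := ι_single_mul_self l
  rw [lipschitzGroup] at hu
  refine Subgroup.closure_induction (p := fun (u : (CliffordAlgebra (-stdForm n))ˣ) _ =>
    ∃ g ∈ consecutiveSubgroup n, ∃ c : ℝ,
    (u : CliffordAlgebra (-stdForm n)) = c • (g : _) ∨
      (u : CliffordAlgebra (-stdForm n)) = c • (g * ι (-stdForm n) (Pi.single l 1)))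
    ?_ ?_ ?_ ?_ hu
  · rintro u ⟨v, hv⟩
    obtain ⟨g, hg, c, h⟩ := exists_ι_eq_smul_conj hl v
    obtain ⟨g', hg', h'⟩ := exists_ι_last_mul hl (inv_mem hg)
    refine ⟨g * g', mul_mem hg hg', c, Or.inr ?_⟩
    rw [← hv, h, mul_assoc, h', Submonoid.coe_mul, mul_assoc]
  · exact ⟨1, one_mem _, 1, Or.inl (by simp)⟩
  · rintro u₁ u₂ - - ⟨g₁, hg₁, c₁, h₁⟩ ⟨g₂, hg₂, c₂, h₂⟩
    obtain ⟨g', hg', h'⟩ := exists_ι_last_mul hl hg₂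
    rcases h₁ with h₁ | h₁ <;> rcases h₂ with h₂ | h₂
    · exact ⟨g₁ * g₂, mul_mem hg₁ hg₂, c₁ * c₂, Or.inl (by
        rw [Units.val_mul, h₁, h₂, smul_mul_smul_comm, Submonoid.coe_mul])⟩
    · exact ⟨g₁ * g₂, mul_mem hg₁ hg₂, c₁ * c₂, Or.inr (by
        rw [Units.val_mul, h₁, h₂, smul_mul_smul_comm, Submonoid.coe_mul, mul_assoc])⟩
    · exact ⟨g₁ * g', mul_mem hg₁ hg', c₁ * c₂, Or.inr (by
        rw [Units.val_mul, h₁, h₂, smul_mul_smul_comm, Submonoid.coe_mul, mul_assoc, h',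
          mul_assoc])⟩
    · refine ⟨g₁ * g', mul_mem hg₁ hg', -(c₁ * c₂), Or.inl ?_⟩
      rw [Units.val_mul, h₁, h₂, smul_mul_smul_comm, Submonoid.coe_mul, mul_assoc,
        ← mul_assoc (ι _ _), h', mul_assoc, hll, mul_neg, mul_one, mul_neg, smul_neg, neg_smul]
  · rintro u - ⟨g, hg, c, h⟩
    have hc : c ≠ 0 := by
      rintro rfl
      rcases h with h | h <;> exact u.ne_zero (by rw [h, zero_smul])
    rcases h with h | h
    · refine ⟨g⁻¹, inv_mem hg, c⁻¹, Or.inl (Units.inv_eq_of_mul_eq_one_right ?_)⟩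
      rw [h, smul_mul_smul_comm, coe_mul_coe_inv, mul_inv_cancel₀ hc, one_smul]
    · obtain ⟨g', hg', h'⟩ := exists_ι_last_mul hl (inv_mem hg)
      refine ⟨g', hg', -c⁻¹, Or.inr (Units.inv_eq_of_mul_eq_one_right ?_)⟩
      rw [h, ← h', smul_mul_smul_comm, mul_assoc, ← mul_assoc (ι _ _), hll, neg_one_mul, mul_neg,
        mul_neg, coe_mul_coe_inv, mul_inv_cancel₀ hc, smul_neg, neg_smul, one_smul, neg_neg]

/-- `Spin(n)` is generated by the copies of `Spin(2)` in the planes `{k, k + 1}`. -/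
theorem consecutiveSubgroup_eq_top {n : ℕ} (hn : 2 ≤ n) : consecutiveSubgroup n = ⊤ := by
  refine eq_top_iff.2 ?_
  rintro ⟨x, hx⟩ -
  obtain ⟨⟨⟨u, hu, rfl⟩, -⟩, -⟩ := id hx
  have hs := spinGroup.star_mul_self_of_mem hx
  have hinv := spinGroup.involute_eq hx
  change star (u : CliffordAlgebra (-stdForm n)) * u = 1 at hs
  change involute (u : CliffordAlgebra (-stdForm n)) = u at hinv
  change (⟨(u : CliffordAlgebra (-stdForm n)), hx⟩ : Spin n) ∈ consecutiveSubgroup n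
  obtain ⟨g, hg, c, h | h⟩ :=
    exists_eq_smul_of_mem_lipschitzGroup (l := ⟨n - 1, by omega⟩) rfl hu
  · rw [h, CliffordAlgebra.star_smul, smul_mul_smul_comm, spinGroup.coe_star_mul_self] at hs
    have hc : c * c = 1 := by
      have h0 : (c * c - 1) • (1 : CliffordAlgebra (-stdForm n)) = 0 := by
        rw [sub_smul, hs, one_smul, sub_self]
      exact sub_eq_zero.1 ((smul_eq_zero.1 h0).resolve_right one_ne_zero)
    rcases mul_self_eq_one_iff.1 hc with rfl | rfl
    · have : (⟨(u : CliffordAlgebra (-stdForm n)), hx⟩ : Spin n) = g :=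
        Subtype.ext (h.trans (one_smul ℝ _))
      rwa [this]
    · have : (⟨(u : CliffordAlgebra (-stdForm n)), hx⟩ : Spin n) =
          spinEmb (consecutive ⟨0, by omega⟩) (spinRot Real.pi) * g := by
        refine Subtype.ext (h.trans ?_)
        rw [Submonoid.coe_mul, coe_spinEmb_spinRot, rotor_pi, neg_one_smul, neg_one_mul]
      rw [this]
      exact mul_mem (spinEmb_mem_consecutiveSubgroup _ _) hg
  -- In the remaining case the element is both even and odd.
  · rw [h, map_smul, map_mul, involute_ι, spinGroup.involute_eq g.2, mul_neg, smul_neg, ← h,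
      neg_eq_iff_add_eq_zero, ← two_smul ℝ] at hinv
    exact absurd ((smul_eq_zero.1 hinv).resolve_left two_ne_zero) u.ne_zero

end generation

/-! ### Chains of subgroups -/

section chain

variable {G : Type*} [Group G]

/-- The subgroup generated by the first `m` members of a sequence of subgroups. -/
def initialSup (A : ℕ → Subgroup G) (m : ℕ) : Subgroup G := ⨆ i : Fin m, A i

theorem le_initialSup (A : ℕ → Subgroup G) {i m : ℕ} (h : i < m) : A i ≤ initialSup A m :=
  le_iSup (fun i : Fin m => A i) ⟨i, h⟩

theorem eq_one_of_mem_initialSup_zero {A : ℕ → Subgroup G} {x : G} (hx : x ∈ initialSup A 0) :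
    x = 1 := by
  rw [initialSup, iSup_of_empty] at hx
  exact hx

theorem commute_of_mem_initialSup {A : ℕ → Subgroup G} {m : ℕ} {x a : G}
    (h : ∀ i, i < m → ∀ b ∈ A i, Commute b a) (hx : x ∈ initialSup A m) : Commute x a := by
  rw [initialSup] at hx
  refine Subgroup.iSup_induction _ (C := fun x => Commute x a) hx
    (fun i b hb => h i i.2 b hb) (Commute.one_left a) fun x y hx hy => hx.mul_left hy

/-- If distant members of a chain of subgroups commute and neighbours `B`, `A` satisfy
`A B A ⊆ B A B`, then the subgroup `K'` generated by an initial segment of the chain is `K A K`,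
where `A` is its last member and `K` is generated by the preceding ones. Indeed `K = L B L` by
induction with `L` commuting with `A`, so that `A K A = L (A B A) L ⊆ L B A B L ⊆ K A K`. -/
theorem exists_eq_mul_mul_of_mem_initialSup {N : ℕ} {A : ℕ → Subgroup G}
    (hcomm : ∀ i j, i + 1 < j → j < N → ∀ a ∈ A i, ∀ b ∈ A j, Commute a b)
    (hbraid : ∀ i, i + 1 < N → ∀ a ∈ A (i + 1), ∀ b ∈ A i, ∀ c ∈ A (i + 1),
      ∃ a' ∈ A i, ∃ b' ∈ A (i + 1), ∃ c' ∈ A i, a * b * c = a' * b' * c')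
    {m : ℕ} (hm : m < N) {x : G} (hx : x ∈ initialSup A (m + 1)) :
    ∃ k ∈ initialSup A m, ∃ a ∈ A m, ∃ k' ∈ initialSup A m, x = k * a * k' := by
  induction m generalizing x with
  | zero =>
    rw [initialSup] at hx
    refine ⟨1, one_mem _, x, ?_, 1, one_mem _, by simp⟩
    refine Subgroup.iSup_induction _ (C := fun x => x ∈ A 0) hx (fun i b hb => ?_) (one_mem _)
      fun _ _ => mul_mem
    rwa [show (i : ℕ) = 0 by omega] at hb
  | succ m ih =>
    rw [initialSup] at hx
    refine Subgroup.iSup_induction _ (C := fun x => ∃ k ∈ initialSup A (m + 1), ∃ a ∈ A (m + 1),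
      ∃ k' ∈ initialSup A (m + 1), x = k * a * k') hx (fun i b hb => ?_)
      ⟨1, one_mem _, 1, one_mem _, 1, one_mem _, by simp⟩ ?_
    · rcases Nat.lt_succ_iff_lt_or_eq.1 i.2 with hi | hi
      · exact ⟨b, le_initialSup A hi hb, 1, one_mem _, 1, one_mem _, by simp⟩
      · exact ⟨1, one_mem _, b, by rwa [hi] at hb, 1, one_mem _, by simp⟩
    · rintro _ _ ⟨k₁, hk₁, a₁, ha₁, k₁', hk₁', rfl⟩ ⟨k₂, hk₂, a₂, ha₂, k₂', hk₂', rfl⟩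
      obtain ⟨l, hl, b, hb, l', hl', h⟩ := ih (by omega) (mul_mem hk₁' hk₂)
      obtain ⟨a', ha', b', hb', c', hc', h'⟩ := hbraid m hm a₁ ha₁ b hb a₂ ha₂
      have hle : initialSup A m ≤ initialSup A (m + 1) :=
        iSup_le fun i => le_initialSup A (i.2.trans m.lt_succ_self)
      have hAm : A m ≤ initialSup A (m + 1) := le_initialSup A m.lt_succ_self
      have hla : l * a₁ = a₁ * l := commute_of_mem_initialSup
        (fun i hi c hc => hcomm i (m + 1) (by omega) hm c hc a₁ ha₁) hl
      have hla' : l' * a₂ = a₂ * l' := commute_of_mem_initialSup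
        (fun i hi c hc => hcomm i (m + 1) (by omega) hm c hc a₂ ha₂) hl'
      refine ⟨k₁ * l * a', mul_mem (mul_mem hk₁ (hle hl)) (hAm ha'), b', hb', c' * l' * k₂',
        mul_mem (mul_mem (hAm hc') (hle hl')) hk₂', ?_⟩
      calc k₁ * a₁ * k₁' * (k₂ * a₂ * k₂') = k₁ * a₁ * (k₁' * k₂) * a₂ * k₂' := by group
        _ = k₁ * (a₁ * l) * b * (l' * a₂) * k₂' := by rw [h]; group
        _ = k₁ * l * (a₁ * b * a₂) * l' * k₂' := by rw [← hla, hla']; group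
        _ = k₁ * l * a' * b' * (c' * l' * k₂') := by rw [h']; group

end chain

/-! ### The rank two groups -/

section rankTwo

theorem spinEmb_comp_spinEmb {m n : ℕ} (f : Fin m ↪ Fin n) (g : Fin 2 ↪ Fin m)
    (h : Fin 2 ↪ Fin n) (hfg : ∀ t, f (g t) = h t) :
    (spinEmb f).comp (spinEmb g) = spinEmb h := by
  ext x
  obtain ⟨t, rfl⟩ := exists_eq_spinRot x
  rw [coe_spinEmb_spinRot]
  change CliffordAlgebra.map (coordIsometry f) (spinEmb g (spinRot t)) = _
  rw [coe_spinEmb_spinRot, ← hfg, ← hfg]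
  simp only [rotor, bivec, map_add, map_smul, map_one, map_mul, map_apply_ι, coordIsometry_single]

/-- The isometry `(x₁, x₂, x₃) ↦ (-x₃, x₂, -x₁)` of `ℝ³`. -/
noncomputable def flipIsometry : (-stdForm 3) →qᵢ (-stdForm 3) where
  toFun v := ![-v 2, v 1, -v 0]
  map_add' v w := by
    ext i
    fin_cases i <;> simp <;> ring
  map_smul' c v := by
    ext i
    fin_cases i <;> simp
  map_app' v := by
    simp [stdForm_apply, Fin.sum_univ_three]
    ring

theorem flipIsometry_single_zero :
    flipIsometry (Pi.single 0 1) = -Pi.single 2 1 := by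
  change ![-(Pi.single 0 1 : Fin 3 → ℝ) 2, (Pi.single 0 1 : Fin 3 → ℝ) 1,
    -(Pi.single 0 1 : Fin 3 → ℝ) 0] = _
  ext i
  fin_cases i <;> simp

theorem flipIsometry_single_one :
    flipIsometry (Pi.single 1 1) = Pi.single 1 1 := by
  change ![-(Pi.single 1 1 : Fin 3 → ℝ) 2, (Pi.single 1 1 : Fin 3 → ℝ) 1,
    -(Pi.single 1 1 : Fin 3 → ℝ) 0] = _
  ext i
  fin_cases i <;> simp

theorem flipIsometry_single_two :
    flipIsometry (Pi.single 2 1) = -Pi.single 0 1 := by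
  change ![-(Pi.single 2 1 : Fin 3 → ℝ) 2, (Pi.single 2 1 : Fin 3 → ℝ) 1,
    -(Pi.single 2 1 : Fin 3 → ℝ) 0] = _
  ext i
  fin_cases i <;> simp

/-- The rank two groups have an endomorphism that exchanges the two connecting homomorphisms. For
an edge, it is induced by the isometry `e₁ ↦ -e₃`, `e₂ ↦ e₂`, `e₃ ↦ -e₁`, whose signs give
`e₁e₂ ↦ e₂e₃` and `e₂e₃ ↦ e₁e₂`. -/
theorem exists_swap_spinLower_spinUpper (b : Bool) :
    ∃ f : SpinRankTwo b →* SpinRankTwo b,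
      f.comp (spinLower b) = spinUpper b ∧ f.comp (spinUpper b) = spinLower b := by
  cases b with
  | false =>
    exact ⟨(MulEquiv.prodComm (M := Spin 2) (N := Spin 2)).toMonoidHom, rfl, rfl⟩
  | true =>
    refine ⟨spinMap flipIsometry, MonoidHom.ext fun x => Subtype.ext ?_,
      MonoidHom.ext fun x => Subtype.ext ?_⟩
    · obtain ⟨t, rfl⟩ := exists_eq_spinRot x
      change CliffordAlgebra.map flipIsometry (spinEmb Fin.castSuccEmb (spinRot t) : Spin 3) =
        (spinEmb (Fin.succEmb 2) (spinRot t) : Spin 3)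
      rw [coe_spinEmb_spinRot, coe_spinEmb_spinRot]
      change CliffordAlgebra.map flipIsometry (rotor (bivec 0 1) t) = rotor (bivec 1 2) t
      rw [← neg_neg (bivec (1 : Fin 3) 2), ← bivec_swap (i := (1 : Fin 3)) (j := 2) (by simp)]
      simp only [rotor, bivec, map_add, map_smul, map_one, map_mul, map_apply_ι,
        flipIsometry_single_zero, flipIsometry_single_one, map_neg, neg_mul]
    · obtain ⟨t, rfl⟩ := exists_eq_spinRot x
      change CliffordAlgebra.map flipIsometry (spinEmb (Fin.succEmb 2) (spinRot t) : Spin 3) =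
        (spinEmb Fin.castSuccEmb (spinRot t) : Spin 3)
      rw [coe_spinEmb_spinRot, coe_spinEmb_spinRot]
      change CliffordAlgebra.map flipIsometry (rotor (bivec 1 2) t) = rotor (bivec 0 1) t
      rw [← neg_neg (bivec (0 : Fin 3) 1), ← bivec_swap (i := (0 : Fin 3)) (j := 1) (by simp)]
      simp only [rotor, bivec, map_add, map_smul, map_one, map_mul, map_apply_ι,
        flipIsometry_single_two, flipIsometry_single_one, map_neg, mul_neg]

theorem spinLower_range_sup_spinUpper_range (b : Bool) :
    (spinLower b).range ⊔ (spinUpper b).range = ⊤ := by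
  cases b with
  | false =>
    refine eq_top_iff.2 ?_
    rintro ⟨x, y⟩ -
    have : ((x, y) : Spin 2 × Spin 2) = (x, 1) * (1, y) := by simp
    exact this ▸ mul_mem (Subgroup.mem_sup_left ⟨x, rfl⟩) (Subgroup.mem_sup_right ⟨y, rfl⟩)
  | true =>
    refine eq_top_iff.2 ((consecutiveSubgroup_eq_top (n := 3) (by norm_num)).ge.trans ?_)
    refine iSup_le fun k => ?_
    rcases Fin.exists_fin_two.1 ⟨k, rfl⟩ with rfl | rfl
    · exact le_sup_of_le_left (le_of_eq (congrArg (fun f => (spinEmb f).range)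
        (DFunLike.ext _ _ fun t => Fin.ext (Nat.zero_add _))))
    · exact le_sup_of_le_right (le_of_eq (congrArg (fun f => (spinEmb f).range)
        (DFunLike.ext _ _ fun t => Fin.ext (Nat.add_comm _ _))))

theorem spinRankTwo_hom_ext {H : Type*} [Group H] {b : Bool} {f g : SpinRankTwo b →* H}
    (hl : f.comp (spinLower b) = g.comp (spinLower b))
    (hu : f.comp (spinUpper b) = g.comp (spinUpper b)) : f = g := by
  have h : (⊤ : Subgroup (SpinRankTwo b)) ≤ f.eqLocus g := by
    rw [← spinLower_range_sup_spinUpper_range b]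
    refine sup_le ?_ ?_
    · rintro _ ⟨x, rfl⟩
      exact DFunLike.congr_fun hl x
    · rintro _ ⟨x, rfl⟩
      exact DFunLike.congr_fun hu x
  exact MonoidHom.ext fun x => h (Subgroup.mem_top x)

end rankTwo

/-! ### Presentation of the spin groups -/

section presentation

/-- A family of homomorphisms `h k : Spin(2) → H`, indexed by the vertices of a diagram, satisfies
the rank two relations if for any two vertices `k ≠ l` the pair `(h k, h l)` extends to the rank
two group of `{k, l}`. The adjacency of `k` and `l` is recorded by a variable `b`, so that the
condition does not depend on a decision procedure for it. -/
def RankTwoRelations {V : Type*} (Γ : SimpleGraph V) {H : Type*} [Group H]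
    (h : V → Spin 2 →* H) : Prop :=
  ∀ (b : Bool) (k l : V), k ≠ l → (b = true ↔ Γ.Adj k l) →
    ∃ t : SpinRankTwo b →* H, t.comp (spinLower b) = h k ∧ t.comp (spinUpper b) = h l

theorem RankTwoRelations.prod {V : Type*} {Γ : SimpleGraph V} {H K : Type*} [Group H] [Group K]
    {h : V → Spin 2 →* H} {g : V → Spin 2 →* K} (hh : RankTwoRelations Γ h)
    (hg : RankTwoRelations Γ g) : RankTwoRelations Γ fun k => (h k).prod (g k) := by
  intro b k l hkl hb
  obtain ⟨t, ht, ht'⟩ := hh b k l hkl hb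
  obtain ⟨s, hs, hs'⟩ := hg b k l hkl hb
  exact ⟨t.prod s,
    MonoidHom.ext fun x => Prod.ext (DFunLike.congr_fun ht x) (DFunLike.congr_fun hs x),
    MonoidHom.ext fun x => Prod.ext (DFunLike.congr_fun ht' x) (DFunLike.congr_fun hs' x)⟩

theorem rankTwoRelations_spinEmb (n : ℕ) :
    RankTwoRelations (SimpleGraph.pathGraph (n - 1))
      fun k => (spinEmb (consecutive k) : Spin 2 →* Spin n) := by
  have hlt : ∀ (b : Bool) (k l : Fin (n - 1)), k < l →
      (b = true ↔ (SimpleGraph.pathGraph (n - 1)).Adj k l) →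
      ∃ t : SpinRankTwo b →* Spin n, t.comp (spinLower b) = spinEmb (consecutive k) ∧
        t.comp (spinUpper b) = spinEmb (consecutive l) := by
    intro b k l hkl hb
    rw [SimpleGraph.pathGraph_adj] at hb
    have hkl' : k.val < l.val := hkl
    cases b with
    | false =>
      have hne : k.val + 1 ≠ l.val := fun h => Bool.false_ne_true (hb.2 (Or.inl h))
      have hc : ∀ a c : Spin 2, Commute (spinEmb (consecutive k) a : Spin n)
          (spinEmb (consecutive l) c) := commute_spinEmb fun s t => Fin.ne_of_val_ne (by
            change k.val + s ≠ l.val + t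
            omega)
      exact ⟨MonoidHom.noncommCoprod _ _ hc, MonoidHom.noncommCoprod_comp_inl _ _ hc,
        MonoidHom.noncommCoprod_comp_inr _ _ hc⟩
    | true =>
      have hl : l.val = k.val + 1 := by
        have := hb.1 rfl
        omega
      let f : Fin 3 ↪ Fin n := ⟨fun t => ⟨k + t, by omega⟩, fun s t h => by
        have := congrArg Fin.val h
        exact Fin.ext (by simpa using this)⟩
      refine ⟨spinEmb f, spinEmb_comp_spinEmb _ _ _ fun t => rfl,
        spinEmb_comp_spinEmb _ _ _ fun t => Fin.ext ?_⟩
      change k.val + (t.val + 1) = l.val + t.val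
      omega
  intro b k l hkl hb
  rcases lt_or_gt_of_ne hkl with h | h
  · exact hlt b k l h hb
  · obtain ⟨t, ht, ht'⟩ := hlt b l k h (hb.trans (SimpleGraph.adj_comm _ _ _))
    obtain ⟨f, hf, hf'⟩ := exists_swap_spinLower_spinUpper b
    exact ⟨t.comp f, by rw [MonoidHom.comp_assoc, hf, ht'], by rw [MonoidHom.comp_assoc, hf', ht]⟩

section relations

variable {n : ℕ} {H : Type*} [Group H] {h : Fin (n - 1) → Spin 2 →* H}

theorem RankTwoRelations.commute (hh : RankTwoRelations (SimpleGraph.pathGraph (n - 1)) h)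
    {k l : Fin (n - 1)} (hkl : k.val + 1 < l.val) (a b : Spin 2) : Commute (h k a) (h l b) := by
  obtain ⟨t, ht, ht'⟩ := hh false k l (Fin.ne_of_val_ne (by omega)) (by
    rw [SimpleGraph.pathGraph_adj]
    simp only [Bool.false_eq_true, false_iff]
    omega)
  rw [← ht, ← ht']
  exact (MonoidHom.commute_inl_inr a b).map t

theorem RankTwoRelations.exists_spin_three
    (hh : RankTwoRelations (SimpleGraph.pathGraph (n - 1)) h)
    {k l : Fin (n - 1)} (hkl : k.val + 1 = l.val) :
    ∃ t : Spin 3 →* H, (∀ a, t (spinEmb Fin.castSuccEmb a) = h k a) ∧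
      ∀ a, t (spinEmb (Fin.succEmb 2) a) = h l a := by
  obtain ⟨t, ht, ht'⟩ := hh true k l (Fin.ne_of_val_ne (by omega)) (by
    rw [SimpleGraph.pathGraph_adj]
    simp [hkl])
  exact ⟨t, fun a => DFunLike.congr_fun ht a, fun a => DFunLike.congr_fun ht' a⟩

theorem RankTwoRelations.braid (hh : RankTwoRelations (SimpleGraph.pathGraph (n - 1)) h)
    {k l : Fin (n - 1)} (hkl : k.val + 1 = l.val) (a b c : Spin 2) :
    ∃ a' b' c', h l a * h k b * h l c = h k a' * h l b' * h k c' := by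
  obtain ⟨t, ht, ht'⟩ := hh.exists_spin_three hkl
  obtain ⟨a', b', c', H⟩ := exists_spinEmb_euler (g := Fin.succEmb 2)
    (f := (Fin.castSuccEmb : Fin 2 ↪ Fin 3)) rfl (by decide) a b c
  refine ⟨a', b', c', ?_⟩
  simpa only [map_mul, ht, ht'] using congrArg t H

/-- The element `-1` of `Spin(2)` has the same image under neighbouring members of the family. -/
theorem RankTwoRelations.apply_spinRot_pi
    (hh : RankTwoRelations (SimpleGraph.pathGraph (n - 1)) h)
    {k l : Fin (n - 1)} (hkl : k.val + 1 = l.val) :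
    h l (spinRot Real.pi) = h k (spinRot Real.pi) := by
  obtain ⟨t, ht, ht'⟩ := hh.exists_spin_three hkl
  rw [← ht, ← ht', spinEmb_spinRot_pi]

/-- The images of the members of a family of homomorphisms `Spin(2) → H`, as a sequence of
subgroups, extended by the trivial group. -/
noncomputable def rangeSeq (h : Fin (n - 1) → Spin 2 →* H) (i : ℕ) : Subgroup H :=
  ⨆ hi : i < n - 1, (h ⟨i, hi⟩).range

theorem rangeSeq_of_lt {i : ℕ} (hi : i < n - 1) : rangeSeq h i = (h ⟨i, hi⟩).range := by
  rw [rangeSeq, iSup_pos hi]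

end relations

/-- If the rotor of angle `θ` in the plane `{i, j}` commutes with `e_j`, then it is `±1`. -/
theorem sin_eq_zero_of_commute_rotor {n : ℕ} {i j : Fin n} (hij : i ≠ j) {θ : ℝ}
    (h : Commute (rotor (bivec i j) θ) (ι (-stdForm n) (Pi.single j 1))) : Real.sin θ = 0 := by
  have h1 : bivec i j * ι (-stdForm n) (Pi.single j 1) = -ι (-stdForm n) (Pi.single i 1) := by
    rw [bivec, mul_assoc, ι_single_mul_self, mul_neg, mul_one]
  have h2 : ι (-stdForm n) (Pi.single j 1) * bivec i j = ι (-stdForm n) (Pi.single i 1) := by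
    rw [bivec, ← mul_assoc, ι_single_mul_ι_single hij, neg_mul, mul_assoc, ι_single_mul_self,
      mul_neg, mul_one, neg_neg]
  have h3 := h.eq
  simp only [rotor, add_mul, mul_add, smul_mul_assoc, mul_smul_comm, h1, h2, one_mul,
    mul_one] at h3
  have h4 : (2 * Real.sin θ) • ι (-stdForm n) (Pi.single i 1) = 0 := by
    rw [← sub_eq_zero] at h3
    rw [← neg_eq_zero, ← h3]
    module
  rcases smul_eq_zero.1 h4 with h5 | h5
  · linarith
  · have := ι_single_mul_self i
    rw [h5, zero_mul] at this
    exact absurd (neg_eq_zero.1 this.symm) one_ne_zero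

theorem spinRot_eq_one_or_of_sin_eq_zero {θ : ℝ} (h : Real.sin θ = 0) :
    spinRot θ = 1 ∨ spinRot θ = spinRot Real.pi := by
  rcases Real.sin_eq_zero_iff_cos_eq.1 h with hc | hc
  · exact Or.inl (Subtype.ext (by
      change rotor _ θ = 1
      rw [rotor, h, hc, one_smul, zero_smul, add_zero]))
  · exact Or.inr (Subtype.ext (by
      change rotor _ θ = rotor _ Real.pi
      rw [rotor_pi, rotor, h, hc, neg_one_smul, zero_smul, add_zero]))

/-- In the group generated by the pairs `(h k a, ε̃_{k, k+1} a)`, the second component determines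
the first. Write an element of the group `K'` of the first `m + 1` copies as `k a k'`, with `k` and
`k'` in the group `K` of the first `m` copies and `a` in the last copy. If `k a k'` lies over `1`,
then `a` lies over an element of `Spin(2)` that centralizes a basis vector which it would otherwise
rotate, so `a` is the image of `±1`. For `m ≥ 1` the image of `-1` also belongs to the previous
copy, so that `k a k'` is in `K`, and induction applies. -/
theorem eq_one_of_mem_initialSup_of_snd_eq_one {n : ℕ} {H : Type*} [Group H]
    {h : Fin (n - 1) → Spin 2 →* H} (hh : RankTwoRelations (SimpleGraph.pathGraph (n - 1)) h)
    {m : ℕ} (hm : m ≤ n - 1) {x : H × Spin n}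
    (hx : x ∈ initialSup (rangeSeq fun k => (h k).prod (spinEmb (consecutive k))) m)
    (hx1 : x.2 = 1) : x = 1 := by
  have hp := hh.prod (rankTwoRelations_spinEmb n)
  obtain ⟨A, hA⟩ : ∃ A, A = rangeSeq fun k => (h k).prod (spinEmb (consecutive k)) := ⟨_, rfl⟩
  rw [← hA] at hx
  have hmem : ∀ i (hi : i < n - 1) y, y ∈ A i ↔
      ∃ a, (h ⟨i, hi⟩).prod (spinEmb (consecutive ⟨i, hi⟩)) a = y := by
    intro i hi y
    rw [hA, rangeSeq_of_lt hi, MonoidHom.mem_range]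
  induction m generalizing x with
  | zero => exact eq_one_of_mem_initialSup_zero hx
  | succ m ih =>
    obtain ⟨k, hk, a, ha, k', hk', rfl⟩ := exists_eq_mul_mul_of_mem_initialSup (N := n - 1)
      (fun i j hij hj a ha b hb => by
        obtain ⟨a, rfl⟩ := (hmem i (by omega) _).1 ha
        obtain ⟨b, rfl⟩ := (hmem j hj _).1 hb
        exact hp.commute hij a b)
      (fun i hi a ha b hb c hc => by
        obtain ⟨a, rfl⟩ := (hmem _ hi _).1 ha
        obtain ⟨b, rfl⟩ := (hmem i (by omega) _).1 hb
        obtain ⟨c, rfl⟩ := (hmem _ hi _).1 hc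
        obtain ⟨a', b', c', H⟩ := hp.braid (k := ⟨i, by omega⟩) (l := ⟨i + 1, hi⟩) rfl a b c
        exact ⟨_, (hmem i (by omega) _).2 ⟨a', rfl⟩, _, (hmem _ hi _).2 ⟨b', rfl⟩,
          _, (hmem i (by omega) _).2 ⟨c', rfl⟩, H⟩) (show m < n - 1 by omega) hx
    obtain ⟨a, rfl⟩ := (hmem m (by omega) _).1 ha
    obtain ⟨θ, rfl⟩ := exists_eq_spinRot a
    rcases Nat.eq_zero_or_pos m with rfl | hm0
    · obtain rfl := eq_one_of_mem_initialSup_zero hk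
      obtain rfl := eq_one_of_mem_initialSup_zero hk'
      rw [one_mul, mul_one] at hx1 ⊢
      have : spinRot θ = 1 := spinEmb_two_injective _ (hx1.trans (map_one _).symm)
      rw [this, map_one]
    -- The elements of the smaller group commute with the basis vector `e_{m+1}` (counted from
    -- `0`), hence so does the middle factor.
    have hfix : ∀ y ∈ initialSup A m, Commute (y.2 : CliffordAlgebra (-stdForm n))
        (ι (-stdForm n) (Pi.single ⟨m + 1, by omega⟩ 1)) := by
      intro y hy
      rw [initialSup] at hy
      refine Subgroup.iSup_induction _ (C := fun y : H × Spin n =>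
        Commute (y.2 : CliffordAlgebra (-stdForm n))
          (ι (-stdForm n) (Pi.single ⟨m + 1, by omega⟩ 1))) hy (fun i b hb => ?_)
        (Commute.one_left _) fun y z hy hz => hy.mul_left hz
      obtain ⟨b, rfl⟩ := (hmem i (by omega) _).1 hb
      obtain ⟨φ, rfl⟩ := exists_eq_spinRot b
      change Commute ((spinEmb (consecutive ⟨i, by omega⟩) (spinRot φ) : Spin n) :
        CliffordAlgebra (-stdForm n)) _
      rw [coe_spinEmb_consecutive]
      exact ((commute_ι_single_bivec (Fin.ne_of_val_ne (by simp; omega))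
        (Fin.ne_of_val_ne (by simp; omega))).rotor_right φ).symm
    have hmid : (spinEmb (consecutive ⟨m, by omega⟩) (spinRot θ) : Spin n) = (k⁻¹ * k'⁻¹).2 := by
      have : k.2 * spinEmb (consecutive ⟨m, by omega⟩) (spinRot θ) * k'.2 = 1 := hx1
      rw [Prod.snd_mul, Prod.snd_inv, Prod.snd_inv, eq_mul_inv_iff_mul_eq, eq_comm,
        inv_eq_iff_mul_eq_one, ← mul_assoc, this]
    have hcomm := hfix _ (mul_mem (inv_mem hk) (inv_mem hk'))
    rw [← hmid, coe_spinEmb_consecutive] at hcomm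
    have hsin := sin_eq_zero_of_commute_rotor (Fin.ne_of_val_ne (by simp)) hcomm
    refine ih (by omega) hx1 (mul_mem (mul_mem hk ?_) hk')
    rcases spinRot_eq_one_or_of_sin_eq_zero hsin with h1 | h1
    · rw [h1, map_one]
      exact one_mem _
    · rw [h1, hp.apply_spinRot_pi (k := ⟨m - 1, by omega⟩) (Nat.sub_add_cancel hm0)]
      exact le_initialSup A (show m - 1 < m by omega) ((hmem _ (by omega) _).2 ⟨_, rfl⟩)

/-- Presentation of `Spin(n)`: a family of homomorphisms from `Spin(2)` that satisfies the rank two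
relations of the diagram `A_{n-1}` extends to `Spin(n)`. -/
theorem RankTwoRelations.exists_hom {n : ℕ} (hn : 2 ≤ n) {H : Type*} [Group H]
    {h : Fin (n - 1) → Spin 2 →* H} (hh : RankTwoRelations (SimpleGraph.pathGraph (n - 1)) h) :
    ∃ π : Spin n →* H, ∀ k, π.comp (spinEmb (consecutive k)) = h k := by
  obtain ⟨A, hA⟩ : ∃ A, A = rangeSeq fun k => (h k).prod (spinEmb (consecutive k)) := ⟨_, rfl⟩
  have hmem : ∀ k a, (h k a, spinEmb (consecutive k) a) ∈ initialSup A (n - 1) := by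
    intro k a
    refine le_initialSup A k.2 ?_
    rw [hA, rangeSeq_of_lt k.2]
    exact ⟨a, rfl⟩
  -- The graph of the required homomorphism projects isomorphically onto `Spin(n)`.
  let p : initialSup A (n - 1) →* Spin n := (MonoidHom.snd H (Spin n)).comp (Subgroup.subtype _)
  have hinj : Function.Injective p := by
    rw [injective_iff_map_eq_one]
    rintro ⟨x, hx⟩ hx1
    exact Subtype.ext (eq_one_of_mem_initialSup_of_snd_eq_one hh le_rfl (hA ▸ hx) hx1)
  have hsurj : Function.Surjective p := by
    rw [← MonoidHom.range_eq_top, eq_top_iff, ← consecutiveSubgroup_eq_top hn]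
    refine iSup_le fun k => ?_
    rintro _ ⟨a, rfl⟩
    exact ⟨⟨_, hmem k a⟩, rfl⟩
  let e := MulEquiv.ofBijective p ⟨hinj, hsurj⟩
  refine ⟨((MonoidHom.fst H (Spin n)).comp (Subgroup.subtype _)).comp e.symm.toMonoidHom,
    fun k => MonoidHom.ext fun a => ?_⟩
  have : e.symm (spinEmb (consecutive k) a) = ⟨_, hmem k a⟩ := e.symm_apply_eq.2 rfl
  change (e.symm (spinEmb (consecutive k) a)).1.1 = h k a
  rw [this]

end presentation

/-! ### The standard amalgam -/

section amalgam

theorem exists_mem_offDiagPair {I : Type*} [Nontrivial I] (i : I) :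
    ∃ e : OffDiagPair I, i ∈ e.1 := by
  obtain ⟨j, hj⟩ := exists_ne i
  exact ⟨⟨s(i, j), fun h => hj (Sym2.mk_isDiag_iff.1 h).symm⟩, Sym2.mem_mk_left i j⟩

theorem exists_lt_of_offDiagPair {I : Type*} [LinearOrder I] (e : OffDiagPair I) :
    ∃ i j, i < j ∧ e.1 = s(i, j) := by
  obtain ⟨e, he⟩ := e
  induction e using Sym2.ind with
  | _ i j =>
    rcases lt_or_gt_of_ne (fun h => he (Sym2.mk_isDiag_iff.2 h) : i ≠ j) with h | h
    · exact ⟨i, j, h, rfl⟩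
    · exact ⟨j, i, h, Sym2.eq_swap⟩

variable {I V : Type*} [LinearOrder I] {Γ : SimpleGraph V} {σ : I ≃ V}

theorem stdSpinAmalgam_φ_left {e : OffDiagPair I} {i j : I} (hij : i < j) (he : e.1 = s(i, j))
    (hi : i ∈ e.1) : (stdSpinAmalgam Γ σ).φ e i hi = spinLower _ :=
  if_pos (by rw [he, Sym2.inf_mk, inf_eq_left.2 hij.le])

theorem stdSpinAmalgam_φ_right {e : OffDiagPair I} {i j : I} (hij : i < j) (he : e.1 = s(i, j))
    (hj : j ∈ e.1) : (stdSpinAmalgam Γ σ).φ e j hj = spinUpper _ :=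
  if_neg (by rw [he, Sym2.inf_mk, inf_eq_left.2 hij.le]; exact hij.ne')

/-- A family of homomorphisms from `Spin(2)` that satisfies the rank two relations extends to the
groups of the standard amalgam. -/
theorem RankTwoRelations.exists_extension {H : Type*} [Group H] {h : V → Spin 2 →* H}
    (hh : RankTwoRelations Γ h) (e : OffDiagPair I) :
    ∃ t : (stdSpinAmalgam Γ σ).G e →* H,
      ∀ i hi, t.comp ((stdSpinAmalgam Γ σ).φ e i hi) = h (σ i) := by
  classical
  obtain ⟨i, j, hij, he⟩ := exists_lt_of_offDiagPair e
  obtain ⟨t, ht, ht'⟩ := hh (decide (e.1.map σ ∈ Γ.edgeSet)) (σ i) (σ j)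
    (σ.injective.ne hij.ne) (by rw [he]; simp)
  refine ⟨t, fun k hk => ?_⟩
  rcases Sym2.mem_iff.1 (he ▸ hk) with rfl | rfl
  · rw [stdSpinAmalgam_φ_left hij he]
    exact ht
  · rw [stdSpinAmalgam_φ_right hij he]
    exact ht'

theorem stdSpinAmalgam_hom_ext {H : Type*} [Group H] {e : OffDiagPair I}
    {f g : (stdSpinAmalgam Γ σ).G e →* H}
    (hfg : ∀ i hi, f.comp ((stdSpinAmalgam Γ σ).φ e i hi) =
      g.comp ((stdSpinAmalgam Γ σ).φ e i hi)) : f = g := by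
  obtain ⟨i, j, hij, he⟩ := exists_lt_of_offDiagPair e
  have h1 := hfg i (he ▸ Sym2.mem_mk_left i j)
  have h2 := hfg j (he ▸ Sym2.mem_mk_right i j)
  rw [stdSpinAmalgam_φ_left hij he] at h1
  rw [stdSpinAmalgam_φ_right hij he] at h2
  exact spinRankTwo_hom_ext h1 h2

/-- An enveloping group of the standard amalgam carries a family of homomorphisms from `Spin(2)`
that satisfies the rank two relations. -/
theorem UAmalgam.IsEnveloping.exists_rankTwoRelations [Nontrivial I] {H : Type*} [Group H]
    {τ : ∀ e, (stdSpinAmalgam Γ σ).G e →* H} (hτ : (stdSpinAmalgam Γ σ).IsEnveloping τ) :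
    ∃ h : V → Spin 2 →* H, RankTwoRelations Γ h ∧
      ∀ e i hi, (τ e).comp ((stdSpinAmalgam Γ σ).φ e i hi) = h (σ i) := by
  classical
  choose E hE using exists_mem_offDiagPair (I := I)
  obtain ⟨h, hh⟩ : ∃ h : V → Spin 2 →* H,
      ∀ e i hi, (τ e).comp ((stdSpinAmalgam Γ σ).φ e i hi) = h (σ i) := by
    refine ⟨fun k => (τ (E (σ.symm k))).comp ((stdSpinAmalgam Γ σ).φ _ _ (hE (σ.symm k))),
      fun e i hi => ?_⟩
    have key : ∀ j, j = i → (τ e).comp ((stdSpinAmalgam Γ σ).φ e i hi) =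
        (τ (E j)).comp ((stdSpinAmalgam Γ σ).φ _ _ (hE j)) := by
      rintro j rfl
      exact hτ.compatible _ _ _ _ _
    exact key _ (σ.symm_apply_apply i)
  have hlt : ∀ (b : Bool) (i j : I), i < j → (b = true ↔ Γ.Adj (σ i) (σ j)) →
      ∃ t : SpinRankTwo b →* H, t.comp (spinLower b) = h (σ i) ∧
        t.comp (spinUpper b) = h (σ j) := by
    intro b i j hij hb
    let e : OffDiagPair I := ⟨s(i, j), fun h => hij.ne (Sym2.mk_isDiag_iff.1 h)⟩
    obtain rfl : b = decide (e.1.map σ ∈ Γ.edgeSet) := by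
      rw [Bool.eq_iff_iff, hb, decide_eq_true_iff]
      rfl
    refine ⟨τ e, ?_, ?_⟩
    · rw [← hh e i (Sym2.mem_mk_left i j), stdSpinAmalgam_φ_left hij rfl]
      rfl
    · rw [← hh e j (Sym2.mem_mk_right i j), stdSpinAmalgam_φ_right hij rfl]
      rfl
  refine ⟨h, fun b k l hkl hb => ?_, hh⟩
  obtain ⟨i, rfl⟩ := σ.surjective k
  obtain ⟨j, rfl⟩ := σ.surjective l
  rcases lt_or_gt_of_ne (fun h => hkl (congrArg σ h) : i ≠ j) with hij | hij
  · exact hlt b i j hij hb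
  · obtain ⟨t, ht, ht'⟩ := hlt b j i hij (hb.trans (SimpleGraph.adj_comm _ _ _))
    obtain ⟨f, hf, hf'⟩ := exists_swap_spinLower_spinUpper b
    exact ⟨t.comp f, by rw [MonoidHom.comp_assoc, hf, ht'], by rw [MonoidHom.comp_assoc, hf', ht]⟩

end amalgam

/-- For `n ≥ 3` and every labelling `σ` of the diagram `A_{n-1}`, the group `Spin(n)` is a universal
enveloping group of the standard `Spin(2)`-amalgam of type `A_{n-1}`, by enveloping homomorphisms
that restrict to the standard embeddings `ε̃_{σ i, σ i + 1}` on the copies of `Spin(2)`. -/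
theorem mainTheorem7 (n : ℕ) (hn : 3 ≤ n) (σ : Fin (n - 1) ≃ Fin (n - 1)) :
    ∃ τ : ∀ e, (stdSpinAmalgam (SimpleGraph.pathGraph (n - 1)) σ).G e →* Spin n,
      UAmalgam.IsUniversalEnveloping.{w}
        (stdSpinAmalgam (SimpleGraph.pathGraph (n - 1)) σ) τ ∧
      ∀ (e : OffDiagPair (Fin (n - 1))) (i : Fin (n - 1)) (hi : i ∈ e.1),
        (τ e).comp ((stdSpinAmalgam (SimpleGraph.pathGraph (n - 1)) σ).φ e i hi) =
          spinEmb (consecutive (σ i)) := by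
  have : Nontrivial (Fin (n - 1)) := Fin.nontrivial_iff_two_le.2 (by omega)
  choose τ hτ using fun e => (rankTwoRelations_spinEmb n).exists_extension (σ := σ) e
  have hgen : ⨆ e, (τ e).range = ⊤ := by
    rw [eq_top_iff, ← consecutiveSubgroup_eq_top (by omega : 2 ≤ n)]
    refine iSup_le fun k => ?_
    obtain ⟨i, rfl⟩ := σ.surjective k
    obtain ⟨e, he⟩ := exists_mem_offDiagPair i
    rw [← hτ e i he]
    rintro _ ⟨a, rfl⟩
    exact Subgroup.mem_iSup_of_mem e ⟨_, rfl⟩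
  refine ⟨τ, ⟨⟨hgen, fun e e' j hj hj' => by rw [hτ, hτ]⟩, fun H _ τ' hτ' => ?_⟩, hτ⟩
  obtain ⟨h, hh, hτh⟩ := hτ'.exists_rankTwoRelations
  obtain ⟨π, hπ⟩ := hh.exists_hom (by omega)
  have hπτ : ∀ e, π.comp (τ e) = τ' e := fun e => stdSpinAmalgam_hom_ext fun i hi => by
    rw [MonoidHom.comp_assoc, hτ, hπ, hτh]
  refine ⟨π, ⟨?_, hπτ⟩, fun π' hπ' => ?_⟩
  · rw [← MonoidHom.range_eq_top, eq_top_iff, ← hτ'.generates]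
    refine iSup_le fun e => ?_
    rintro _ ⟨a, rfl⟩
    exact ⟨τ e a, DFunLike.congr_fun (hπτ e) a⟩
  · have hle : (⊤ : Subgroup (Spin n)) ≤ π'.eqLocus π := by
      rw [← hgen]
      refine iSup_le fun e => ?_
      rintro _ ⟨a, rfl⟩
      exact (DFunLike.congr_fun (hπ'.2 e) a).trans (DFunLike.congr_fun (hπτ e) a).symm
    exact MonoidHom.ext fun x => hle (Subgroup.mem_top x)
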